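/- **Proposition 3.1.** Let $\Omega_{\mathrm{loc}}\subseteq\mathbb{R}^d$ be closed and $A\subseteq\mathbb{R}^m$ compact, and let $\mathcal{M}_1(\Omega_{\mathrm{loc}})$ be the set of Borel probability measures on $\Omega_{\mathrm{loc}}$. For $p\in\mathbb{N}_0$ let $C_p(\Omega_{\mathrm{loc}},\mathbb{R})$ be the set of continuous $g:\Omega_{\mathrm{loc}}\to\mathbb{R}$ with $\sup_{x}|g(x)|/(1+\|x\|^p)<\infty$ (Euclidean norm), and let $\tau_p$ be the topology on $\mathcal{M}_1(\Omega_{\mathrm{loc}})$ in which $\mu_n\to\mu$ means $\int g\,d\mu_n\to\int g\,d\mu$ for all $g\in C_p(\Omega_{\mathrm{loc}},\mathbb{R})$, that is, the coarsest topology making all maps $\mu\mapsto\int g\,d\mu$, $g\in C_p(\Omega_{\mathrm{loc}},\mathbb{R})$, continuous (it is considered only on sets of measures with finite $p$-th moments); $\tau_0$ is the topology of weak convergence. Fix an integer $q\ge 1$ and a real $\varepsilon>0$, and for $\mu,\nu\in\mathcal{M}_1(\Omega_{\mathrm{loc}})$ let $$W_q(\mu,\nu)=\Big(\inf_{\pi}\int\|x-y\|^q\,d\pi(x,y)\Big)^{1/q}\in[0,\infty],$$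 the infimum being over all joint distributions $\pi$ of $\mu$ and $\nu$ on $\Omega_{\mathrm{loc}}\times\Omega_{\mathrm{loc}}$. Let $\widehat{\mathbb{P}}:\Omega_{\mathrm{loc}}\times A\to(\mathcal{M}_1(\Omega_{\mathrm{loc}}),\tau_q)$ be continuous and such that $\widehat{\mathbb{P}}(x,a)$ has a finite $q$-th moment for every $(x,a)$. Define $$\mathcal{P}(x,a)=\{\mathbb{P}\in\mathcal{M}_1(\Omega_{\mathrm{loc}}) : W_q(\mathbb{P},\widehat{\mathbb{P}}(x,a))\le\varepsilon\}.$$ Then the correspondence $(x,a)\mapsto\mathcal{P}(x,a)$ from $\Omega_{\mathrm{loc}}\times A$ to $\mathcal{M}_1(\Omega_{\mathrm{loc}})$ with the topology of weak convergence is nonempty-valued, compact-valued and continuous, i.e. upper hemicontinuous ($\{(x,a):\mathcal{P}(x,a)\subseteq U\}$ is open for every open $U$) and lower hemicontinuous ($\{(x,a):\mathcal{P}(x,a)\cap U\neq\emptyset\}$ is open for every open $U$). Consequently $\mathcal{P}$ satisfies, with $p=0$, the following assumption: (i) as a correspondence into $(\mathcal{M}_1(\Omega_{\mathrm{loc}}),\tau_p)$,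 $\mathcal{P}$ is nonempty-valued, compact-valued and continuous; (ii) there is $C_P\ge1$ such that $\int(1+\|y\|^p)\,\mathbb{P}(dy)\le C_P(1+\|x\|^p)$ for all $(x,a)\in\Omega_{\mathrm{loc}}\times A$ and all $\mathbb{P}\in\mathcal{P}(x,a)$. -/

import Mathlib

open MeasureTheory Topology
open scoped ENNReal

namespace WassersteinAmbiguity

/-- The set `C_p(Ω, ℝ)` of continuous functions `g : Ω → ℝ` of polynomial growth of degree at
most `p`, that is, with `sup_x |g x| / (1 + ‖x‖ ^ p) < ∞` (Euclidean norm). -/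
def polyGrowth {d : ℕ} (Ω : Set (EuclideanSpace ℝ (Fin d))) (p : ℕ) : Set (Ω → ℝ) :=
  {g | Continuous g ∧
    BddAbove (Set.range fun x : Ω => |g x| / (1 + ‖(x : EuclideanSpace ℝ (Fin d))‖ ^ p))}

/-- The measure `μ` has a finite `q`-th moment. -/
def HasFiniteMoment {d : ℕ} {Ω : Set (EuclideanSpace ℝ (Fin d))} (q : ℕ)
    (μ : ProbabilityMeasure Ω) : Prop :=
  Integrable (fun y : Ω => ‖(y : EuclideanSpace ℝ (Fin d))‖ ^ q) (μ : Measure Ω)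

/-- The topology `τ_p` on the probability measures on `Ω`: the coarsest topology for which
`μ ↦ ∫ g dμ` is continuous for every `g ∈ C_p(Ω, ℝ)`. All these integrals are finite if `μ` has a
finite `p`-th moment, and `τ_p` is only ever used on sets of such measures (for `p = 0` these are
all probability measures). -/
noncomputable abbrev tau {d : ℕ} (Ω : Set (EuclideanSpace ℝ (Fin d))) (p : ℕ) :
    TopologicalSpace (ProbabilityMeasure Ω) :=
  ⨅ g ∈ polyGrowth Ω p,
    TopologicalSpace.induced (fun μ : ProbabilityMeasure Ω => ∫ x, g x ∂(μ : Measure Ω))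
      inferInstance

/-- Convergence in `τ_p` is convergence of the integrals of all `g ∈ C_p(Ω, ℝ)`. -/
theorem tendsto_tau_iff {d : ℕ} {Ω : Set (EuclideanSpace ℝ (Fin d))} {p : ℕ} {ι : Type*}
    {l : Filter ι} {μs : ι → ProbabilityMeasure Ω} {μ : ProbabilityMeasure Ω} :
    Filter.Tendsto μs l (@nhds _ (tau Ω p) μ) ↔
      ∀ g ∈ polyGrowth Ω p, Filter.Tendsto (fun i => ∫ x, g x ∂(μs i : Measure Ω)) l
        (𝓝 (∫ x, g x ∂(μ : Measure Ω))) := by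
  rw [tau, nhds_iInf]
  simp only [nhds_iInf, nhds_induced, Filter.tendsto_iInf, Filter.tendsto_comap_iff]
  rfl

/-- `τ_0` is the topology of weak convergence of probability measures. -/
theorem tau_zero {d : ℕ} (Ω : Set (EuclideanSpace ℝ (Fin d))) :
    tau Ω 0 = (inferInstance : TopologicalSpace (ProbabilityMeasure Ω)) := by
  apply le_antisymm
  · rw [← continuous_id_iff_le]
    refine (@ProbabilityMeasure.continuous_iff_forall_continuous_integral
      Ω _ _ _ _ (tau Ω 0) id).2 fun f => ?_
    rw [continuous_iff_le_induced]
    refine iInf₂_le (f : Ω → ℝ) ⟨f.continuous, ‖f‖, ?_⟩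
    rintro _ ⟨x, rfl⟩
    have h := f.norm_coe_le_norm x
    rw [Real.norm_eq_abs] at h
    have h0 := abs_nonneg (f x)
    simp only [pow_zero]
    linarith
  · refine le_iInf₂ fun g hg => ?_
    obtain ⟨hc, C, hC⟩ := hg
    rw [← continuous_iff_le_induced]
    refine ProbabilityMeasure.continuous_integral_boundedContinuousFunction
      (BoundedContinuousFunction.ofNormedAddCommGroup g hc (2 * C) fun x => ?_)
    have h := hC ⟨x, rfl⟩
    simp only [pow_zero] at h
    rw [Real.norm_eq_abs]
    linarith

/-- The set `Π(μ, ν)` of joint distributions (couplings) of `μ` and `ν`. -/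
def couplings {d : ℕ} {Ω : Set (EuclideanSpace ℝ (Fin d))} (μ ν : ProbabilityMeasure Ω) :
    Set (Measure (Ω × Ω)) :=
  {π | π.map Prod.fst = (μ : Measure Ω) ∧ π.map Prod.snd = (ν : Measure Ω)}

/-- The `q`-Wasserstein distance
`W_q(μ, ν) = (inf_{π ∈ Π(μ, ν)} ∫ ‖x - y‖ ^ q dπ(x, y)) ^ (1 / q)`, with values in `[0, ∞]`. -/
noncomputable def wassersteinDist {d : ℕ} {Ω : Set (EuclideanSpace ℝ (Fin d))} (q : ℕ)
    (μ ν : ProbabilityMeasure Ω) : ℝ≥0∞ :=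
  (⨅ π ∈ couplings μ ν,
    ∫⁻ z, ENNReal.ofReal
      (‖(z.1 : EuclideanSpace ℝ (Fin d)) - (z.2 : EuclideanSpace ℝ (Fin d))‖ ^ q) ∂π)
    ^ (1 / (q : ℝ))

/-- The closed `q`-Wasserstein ball with radius `ε` around `μ`. -/
def wassersteinBall {d : ℕ} {Ω : Set (EuclideanSpace ℝ (Fin d))} (q : ℕ) (ε : ℝ)
    (μ : ProbabilityMeasure Ω) : Set (ProbabilityMeasure Ω) :=
  {ν | wassersteinDist q ν μ ≤ ENNReal.ofReal ε}

/-- A correspondence between topological spaces that is nonempty-valued, compact-valued and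
continuous, i.e. both upper and lower hemicontinuous. -/
structure IsCompactContinuous {X Y : Type*} [TopologicalSpace X] [TopologicalSpace Y]
    (φ : X → Set Y) : Prop where
  nonempty : ∀ x, (φ x).Nonempty
  isCompact : ∀ x, IsCompact (φ x)
  upper : UpperHemicontinuous φ
  lower : LowerHemicontinuous φ

/-- `φ` is upper hemicontinuous if and only if `{x | φ x ⊆ U}` is open for all open `U`. -/
theorem upperHemicontinuous_iff_isOpen_subset {X Y : Type*} [TopologicalSpace X]
    [TopologicalSpace Y] {φ : X → Set Y} :
    UpperHemicontinuous φ ↔ ∀ U : Set Y, IsOpen U → IsOpen {x | φ x ⊆ U} := by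
  constructor
  · intro h U hU
    simpa only [hU.mem_nhdsSet] using semicontinuous_iff_isOpen.1 h U
  · intro h x t ht
    obtain ⟨U, hU, hxU, hUt⟩ := mem_nhdsSet_iff_exists.1 ht
    filter_upwards [(h U hU).mem_nhds hxU] with y hy
    exact mem_nhdsSet_iff_exists.2 ⟨U, hU, hy, hUt⟩

/-- `φ` is lower hemicontinuous if and only if `{x | φ x ∩ U ≠ ∅}` is open for all open `U`. -/
theorem lowerHemicontinuous_iff_isOpen_inter {X Y : Type*} [TopologicalSpace X]
    [TopologicalSpace Y] {φ : X → Set Y} :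
    LowerHemicontinuous φ ↔ ∀ U : Set Y, IsOpen U → IsOpen {x | (φ x ∩ U).Nonempty} := by
  constructor
  · intro h U hU
    simpa only [hU, true_and] using semicontinuous_iff_isOpen.1 h U
  · rintro h x t ⟨ht, hx⟩
    filter_upwards [(h t ht).mem_nhds hx] with y hy
    exact ⟨ht, hy⟩

/-- The standing assumptions, with exponent `p`, on the ambiguity correspondence
`(x, a) ↦ P (x, a)`: as a correspondence into `(M_1(Ω), τ_p)` it is nonempty, compact-valued and
continuous, and there is `C ≥ 1` with `∫ (1 + ‖y‖ ^ p) dℙ(y) ≤ C (1 + ‖x‖ ^ p)` for all `(x, a)`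
and all `ℙ ∈ P (x, a)`. -/
structure IsAmbiguityCorrespondence {d m : ℕ} {Ω : Set (EuclideanSpace ℝ (Fin d))}
    {A : Set (EuclideanSpace ℝ (Fin m))} (p : ℕ) (P : Ω × A → Set (ProbabilityMeasure Ω)) :
    Prop where
  regular : @IsCompactContinuous (Ω × A) (ProbabilityMeasure Ω) inferInstance (tau Ω p) P
  growth : ∃ C : ℝ, 1 ≤ C ∧ ∀ (x : Ω) (a : A), ∀ μ ∈ P (x, a),
    ∫⁻ y : Ω, ENNReal.ofReal (1 + ‖(y : EuclideanSpace ℝ (Fin d))‖ ^ p) ∂(μ : Measure Ω) ≤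
      ENNReal.ofReal (C * (1 + ‖(x : EuclideanSpace ℝ (Fin d))‖ ^ p))

end WassersteinAmbiguity

open WassersteinAmbiguity

/-!
A measure `ν` lies in the ball of radius `ε` around `μ` if and only if for every `C > ε ^ q` there
is a coupling of transport cost `< C` (`mem_wassersteinBall_iff`). Optimal couplings are not needed.

*Compact values and upper hemicontinuity.* Let `νᵢ → ν` in `τ_q` along an ultrafilter and let `μᵢ`
lie in the ball around `νᵢ`. Convergence in `τ_q` bounds the `q`-th moments of the `νᵢ`, and the
bound on the cost then bounds those of the `μᵢ`. So near-optimal couplings are tight, and by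
Prokhorov's theorem they converge weakly. The cost is lower semicontinuous, so the limit is a
coupling that shows that `μᵢ` converges to a point of the ball around `ν`
(`exists_tendsto_mem_wassersteinBall`). With a constant centre this is compactness of the ball;
with a moving centre it is upper hemicontinuity.

*Lower hemicontinuity.* Let `μ` lie in the ball around `ν`. Replacing `μ` by
`(1 - t) μ + t ν` one may assume that some coupling `π` has cost strictly below `ε ^ q`
(`exists_lintegral_edist_pow_lt`). Take a finite continuous partition of unity `ψ` on `Ω`,
subordinate to small balls and the complement of a large one, and let `κ i` be the law of `x` under
`π` conditioned with the weight `ψ i y`. For every `ρ` the measure `∑ i, κ i ⊗ (ψ i ρ)` is a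
coupling of `∑ i, ρ(ψ i) κ i` and `ρ` (`mixCoupling`). Its first marginal depends weakly
continuously on `ρ` and is `μ` at `ρ = ν`. Its cost is the integral against `ρ` of a continuous
function with growth of degree `q`, hence `τ_q`-continuous, and by Minkowski's inequality it is
below `ε ^ q` at `ρ = ν` if the partition is fine enough (`exists_mixCoupling`). So for `ρ` close
to `ν` the first marginal is a point of the ball around `ρ` that is close to `μ`.

All integrals are `ℝ≥0∞`-valued lower integrals, with cost `edist x y ^ q` and moments `‖y‖ₑ ^ q`.
-/

namespace WassersteinAmbiguity

open Filter
open scoped NNReal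

variable {d : ℕ} {Ω : Set (EuclideanSpace ℝ (Fin d))}

/-! ### Couplings, transport costs and moments -/

theorem ofReal_norm_sub_pow (q : ℕ) (z : Ω × Ω) :
    ENNReal.ofReal (‖(z.1 : EuclideanSpace ℝ (Fin d)) - (z.2 : EuclideanSpace ℝ (Fin d))‖ ^ q) =
      edist z.1 z.2 ^ q := by
  rw [ENNReal.ofReal_pow (norm_nonneg _), ofReal_norm, ← edist_eq_enorm_sub, Subtype.edist_eq]

/-- Membership in the Wasserstein ball in terms of couplings. No optimal coupling is claimed to
exist, hence the strict inequalities. -/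
theorem mem_wassersteinBall_iff {q : ℕ} (hq : q ≠ 0) {ε : ℝ} {μ ν : ProbabilityMeasure Ω} :
    ν ∈ wassersteinBall q ε μ ↔ ∀ C, ENNReal.ofReal ε ^ q < C →
      ∃ π ∈ couplings ν μ, ∫⁻ z, edist z.1 z.2 ^ q ∂π < C := by
  have hq' : (0 : ℝ) < q := by positivity
  simp only [wassersteinBall, Set.mem_ofPred_eq, wassersteinDist, one_div,
    ENNReal.rpow_inv_le_iff hq', ENNReal.rpow_natCast, ofReal_norm_sub_pow]
  constructor
  · intro h C hC
    simpa only [iInf_lt_iff, exists_prop] using h.trans_lt hC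
  · intro h
    refine le_of_forall_gt fun C hC => ?_
    simpa only [iInf_lt_iff, exists_prop] using h C hC

theorem isProbabilityMeasure_of_mem_couplings {μ ν : ProbabilityMeasure Ω} {π : Measure (Ω × Ω)}
    (hπ : π ∈ couplings μ ν) : IsProbabilityMeasure π := by
  have h : IsProbabilityMeasure (π.map Prod.fst) := by rw [hπ.1]; infer_instance
  exact (Measure.isProbabilityMeasure_map_iff measurable_fst.aemeasurable).1 h

theorem lintegral_fst_of_mem_couplings {μ ν : ProbabilityMeasure Ω} {π : Measure (Ω × Ω)}
    (hπ : π ∈ couplings μ ν) {f : Ω → ℝ≥0∞} (hf : Measurable f) :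
    ∫⁻ z, f z.1 ∂π = ∫⁻ x, f x ∂(μ : Measure Ω) := by
  rw [← hπ.1, lintegral_map hf measurable_fst]

theorem lintegral_snd_of_mem_couplings {μ ν : ProbabilityMeasure Ω} {π : Measure (Ω × Ω)}
    (hπ : π ∈ couplings μ ν) {f : Ω → ℝ≥0∞} (hf : Measurable f) :
    ∫⁻ z, f z.2 ∂π = ∫⁻ x, f x ∂(ν : Measure Ω) := by
  rw [← hπ.2, lintegral_map hf measurable_snd]

theorem diagonal_mem_couplings (μ : ProbabilityMeasure Ω) :
    (μ : Measure Ω).map (fun x => (x, x)) ∈ couplings μ μ := by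
  constructor <;> rw [Measure.map_map (by fun_prop) (by fun_prop)] <;> exact Measure.map_id

theorem lintegral_diagonal {q : ℕ} (hq : q ≠ 0) (μ : ProbabilityMeasure Ω) :
    ∫⁻ z, edist z.1 z.2 ^ q ∂((μ : Measure Ω).map (fun x => (x, x))) = 0 := by
  rw [lintegral_map (by fun_prop) (by fun_prop)]
  simp [hq]

theorem self_mem_wassersteinBall {q : ℕ} (hq : q ≠ 0) (ε : ℝ) (μ : ProbabilityMeasure Ω) :
    μ ∈ wassersteinBall q ε μ :=
  (mem_wassersteinBall_iff hq).2 fun _ hC =>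
    ⟨_, diagonal_mem_couplings μ, by rw [lintegral_diagonal hq]; exact zero_le.trans_lt hC⟩

theorem hasFiniteMoment_iff {q : ℕ} {μ : ProbabilityMeasure Ω} :
    HasFiniteMoment q μ ↔
      ∫⁻ y : Ω, ‖(y : EuclideanSpace ℝ (Fin d))‖ₑ ^ q ∂(μ : Measure Ω) ≠ ∞ := by
  have hm : AEStronglyMeasurable (fun y : Ω => ‖(y : EuclideanSpace ℝ (Fin d))‖ ^ q)
      (μ : Measure Ω) := Continuous.aestronglyMeasurable (by fun_prop)
  simp [HasFiniteMoment, Integrable, hm, hasFiniteIntegral_iff_enorm, lt_top_iff_ne_top]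

theorem ennreal_add_pow_le (q : ℕ) (a b : ℝ≥0∞) : (a + b) ^ q ≤ 2 ^ q * (a ^ q + b ^ q) := by
  wlog h : a ≤ b generalizing a b
  · rw [add_comm a, add_comm (a ^ q)]
    exact this b a (le_of_not_ge h)
  calc (a + b) ^ q ≤ (2 * b) ^ q := by rw [two_mul]; gcongr
    _ = 2 ^ q * b ^ q := mul_pow _ _ _
    _ ≤ 2 ^ q * (a ^ q + b ^ q) := by gcongr; exact le_add_self

theorem enorm_pow_le (q : ℕ) (x y : Ω) :
    ‖(x : EuclideanSpace ℝ (Fin d))‖ₑ ^ q ≤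
      2 ^ q * (edist x y ^ q + ‖(y : EuclideanSpace ℝ (Fin d))‖ₑ ^ q) := by
  have h : ‖(x : EuclideanSpace ℝ (Fin d))‖ₑ ≤
      edist x y + ‖(y : EuclideanSpace ℝ (Fin d))‖ₑ := by
    rw [Subtype.edist_eq]
    simpa only [edist_zero_right] using
      edist_triangle (x : EuclideanSpace ℝ (Fin d)) y 0
  exact (pow_le_pow_left' h q).trans (ennreal_add_pow_le q _ _)

theorem edist_pow_le (q : ℕ) (x y : Ω) :
    edist x y ^ q ≤ 2 ^ q * (‖(x : EuclideanSpace ℝ (Fin d))‖ₑ ^ q +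
      ‖(y : EuclideanSpace ℝ (Fin d))‖ₑ ^ q) := by
  rw [Subtype.edist_eq, edist_eq_enorm_sub]
  exact (pow_le_pow_left' enorm_sub_le q).trans (ennreal_add_pow_le q _ _)

/-! ### Convergence in `τ_q` -/

theorem boundedContinuousFunction_mem_polyGrowth (q : ℕ) (f : BoundedContinuousFunction Ω ℝ) :
    (f : Ω → ℝ) ∈ polyGrowth Ω q := by
  refine ⟨f.continuous, ‖f‖, ?_⟩
  rintro _ ⟨x, rfl⟩
  have h := f.norm_coe_le_norm x
  rw [Real.norm_eq_abs] at h
  exact (div_le_self (abs_nonneg _) (le_add_of_nonneg_right (by positivity))).trans h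

theorem tendsto_of_tendsto_tau {q : ℕ} {ι : Type*} {l : Filter ι}
    {νs : ι → ProbabilityMeasure Ω} {ν : ProbabilityMeasure Ω}
    (h : Tendsto νs l (@nhds _ (tau Ω q) ν)) : Tendsto νs l (𝓝 ν) :=
  ProbabilityMeasure.tendsto_iff_forall_integral_tendsto.2 fun f =>
    tendsto_tau_iff.1 h f (boundedContinuousFunction_mem_polyGrowth q f)

/-- Convergence in `τ_q` gives convergence of lower integrals of continuous `ℝ≥0∞`-valued
functions of growth of degree at most `q`, provided the moments are finite: only then do these
lower integrals agree with the Bochner integrals that define `τ_q`. -/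
theorem tendsto_lintegral_of_tendsto_tau {q : ℕ} {ι : Type*} {l : Filter ι}
    {νs : ι → ProbabilityMeasure Ω} {ν : ProbabilityMeasure Ω}
    (h : Tendsto νs l (@nhds _ (tau Ω q) ν)) (hνs : ∀ i, HasFiniteMoment q (νs i))
    (hν : HasFiniteMoment q ν) {G : Ω → ℝ≥0∞} (hG : Continuous G) {C : ℝ≥0∞} (hC : C ≠ ∞)
    (hGC : ∀ y, G y ≤ C * (1 + ‖(y : EuclideanSpace ℝ (Fin d))‖ₑ ^ q)) :
    Tendsto (fun i => ∫⁻ y, G y ∂(νs i : Measure Ω)) l (𝓝 (∫⁻ y, G y ∂(ν : Measure Ω))) := by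
  have hfin : ∀ y, G y ≠ ∞ := fun y => ne_top_of_le_ne_top (by finiteness) (hGC y)
  have hle : ∀ y, (G y).toReal ≤ C.toReal * (1 + ‖(y : EuclideanSpace ℝ (Fin d))‖ ^ q) := by
    intro y
    have h1 := ENNReal.toReal_mono (by finiteness) (hGC y)
    rwa [ENNReal.toReal_mul, ENNReal.toReal_add (by finiteness) (by finiteness),
      ENNReal.toReal_pow, ENNReal.toReal_one, toReal_enorm] at h1
  have hcont : Continuous fun y => (G y).toReal :=
    continuous_iff_continuousAt.2 fun y =>
      (ENNReal.tendsto_toReal (hfin y)).comp hG.continuousAt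
  have hmem : (fun y => (G y).toReal) ∈ polyGrowth Ω q := by
    refine ⟨hcont, C.toReal, ?_⟩
    rintro _ ⟨y, rfl⟩
    simp only
    rw [abs_of_nonneg ENNReal.toReal_nonneg, div_le_iff₀ (by positivity)]
    exact hle y
  have key : ∀ ρ : ProbabilityMeasure Ω, HasFiniteMoment q ρ →
      ∫⁻ y, G y ∂(ρ : Measure Ω) = ENNReal.ofReal (∫ y, (G y).toReal ∂(ρ : Measure Ω)) := by
    intro ρ hρ
    have hint : Integrable (fun y => (G y).toReal) (ρ : Measure Ω) := by
      refine Integrable.mono' (((integrable_const (1 : ℝ)).add hρ).const_mul C.toReal)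
        hcont.aestronglyMeasurable (ae_of_all _ fun y => ?_)
      rw [Real.norm_of_nonneg ENNReal.toReal_nonneg]
      exact hle y
    rw [ofReal_integral_eq_lintegral_ofReal hint (ae_of_all _ fun _ => ENNReal.toReal_nonneg)]
    exact lintegral_congr fun y => (ENNReal.ofReal_toReal (hfin y)).symm
  simp only [key _ (hνs _), key _ hν]
  exact ENNReal.tendsto_ofReal (tendsto_tau_iff.1 h _ hmem)

/-! ### Tightness and limits of couplings -/

/-- Markov's inequality: a bound on the integrals of a function with compact sublevel sets gives
tightness. -/
theorem isTightMeasureSet_of_lintegral_le {X : Type*} [TopologicalSpace X] [MeasurableSpace X]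
    {N : X → ℝ≥0∞} (hN : Measurable N)
    (hc : ∀ r, r ≠ ∞ → IsCompact {x | N x ≤ r}) {C : ℝ≥0∞} (hC : C ≠ ∞) :
    IsTightMeasureSet {π : Measure X | ∫⁻ x, N x ∂π ≤ C} := by
  rw [isTightMeasureSet_iff_exists_isCompact_measure_compl_le]
  intro ε hε
  by_cases hε' : ε = ∞
  · exact ⟨∅, isCompact_empty, by simp [hε']⟩
  have hr0 : (C + 1) / ε ≠ 0 := by simp [ENNReal.div_eq_zero_iff, hε']
  have hr : (C + 1) / ε ≠ ∞ := ENNReal.div_ne_top (by simpa using hC) hε.ne'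
  refine ⟨_, hc ((C + 1) / ε) hr, fun π hπ => ?_⟩
  calc π {x | N x ≤ (C + 1) / ε}ᶜ ≤ π {x | (C + 1) / ε ≤ N x} :=
        measure_mono fun x hx => (lt_of_not_ge (fun h : N x ≤ _ => hx h)).le
    _ ≤ (∫⁻ x, N x ∂π) / ((C + 1) / ε) := meas_ge_le_lintegral_div hN.aemeasurable hr0 hr
    _ ≤ (C + 1) / ((C + 1) / ε) := by gcongr; exact hπ.out.trans le_self_add
    _ = ε := by
      have : C + 1 ≠ ∞ := by simpa using hC
      rw [ENNReal.div_div_cancel (by simp) this]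

theorem isCompact_setOf_enorm_pow_add_le (hΩ : IsClosed Ω) {q : ℕ} (hq : q ≠ 0) {r : ℝ≥0∞}
    (hr : r ≠ ∞) :
    IsCompact {z : Ω × Ω | ‖(z.1 : EuclideanSpace ℝ (Fin d))‖ₑ ^ q +
      ‖(z.2 : EuclideanSpace ℝ (Fin d))‖ₑ ^ q ≤ r} := by
  have key : ∀ x : EuclideanSpace ℝ (Fin d), ‖x‖ₑ ^ q ≤ r →
      x ∈ Metric.closedBall 0 (max 1 r.toReal) := by
    intro x hx
    rw [mem_closedBall_zero_iff, le_max_iff]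
    refine or_iff_not_imp_left.2 fun h1 => ?_
    have h2 : ‖x‖ ^ q ≤ r.toReal := by
      have := ENNReal.toReal_mono hr hx
      simpa using this
    exact (le_self_pow₀ (not_le.1 h1).le hq).trans h2
  have hK : IsCompact ((Subtype.val : Ω → EuclideanSpace ℝ (Fin d)) ⁻¹'
      Metric.closedBall 0 (max 1 r.toReal)) :=
    hΩ.isClosedEmbedding_subtypeVal.isCompact_preimage (isCompact_closedBall _ _)
  refine (hK.prod hK).of_isClosed_subset (isClosed_le (by fun_prop) continuous_const) ?_
  exact fun z hz => ⟨key _ (le_self_add.trans hz), key _ (le_add_self.trans hz)⟩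

/-- Lower semicontinuity of `π ↦ ∫⁻ c dπ` under weak convergence, for continuous `c`. -/
theorem lintegral_le_of_tendsto {X ι : Type*} [TopologicalSpace X] [MeasurableSpace X]
    [OpensMeasurableSpace X] {l : Filter ι} [l.NeBot] {πs : ι → ProbabilityMeasure X}
    {π : ProbabilityMeasure X} (h : Tendsto πs l (𝓝 π)) {c : X → ℝ≥0∞} (hc : Continuous c)
    {C : ℝ≥0∞} (hC : ∀ᶠ i in l, ∫⁻ x, c x ∂(πs i : Measure X) ≤ C) :
    ∫⁻ x, c x ∂(π : Measure X) ≤ C := by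
  -- The truncations `min (c x) n` are bounded and continuous.
  have hfin : ∀ (n : ℕ) x, min (c x) n ≠ ∞ := fun n x => by simp
  have hsup : ∀ x, c x = ⨆ n : ℕ, min (c x) n := fun x => by
    have := inf_iSup_eq (c x) (fun n : ℕ => (n : ℝ≥0∞))
    rwa [ENNReal.iSup_natCast, inf_top_eq] at this
  have hle : ∀ n : ℕ, ∫⁻ x, min (c x) n ∂(π : Measure X) ≤ C := by
    intro n
    let f : BoundedContinuousFunction X NNReal :=
      BoundedContinuousFunction.mkOfBound
        ⟨fun x => (min (c x) n).toNNReal, by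
          refine continuous_iff_continuousAt.2 fun x => ?_
          exact (ENNReal.tendsto_toNNReal (hfin n x)).comp
            (hc.min continuous_const).continuousAt⟩ n (by
        intro x y
        have hb : ∀ x, ((min (c x) n).toNNReal : ℝ) ≤ n := fun x => by
          have := ENNReal.toNNReal_mono (ENNReal.natCast_ne_top n) (min_le_right (c x) n)
          exact_mod_cast this
        rw [NNReal.dist_eq]
        exact abs_sub_le_of_nonneg_of_le (NNReal.coe_nonneg _) (hb x) (NNReal.coe_nonneg _) (hb y))
    have hf : ∀ x, (f x : ℝ≥0∞) = min (c x) n := fun x => ENNReal.coe_toNNReal (hfin n x)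
    have ht := (ProbabilityMeasure.tendsto_iff_forall_lintegral_tendsto.1 h) f
    simp only [hf] at ht
    refine le_of_tendsto ht ?_
    filter_upwards [hC] with i hi
    exact (lintegral_mono fun x => min_le_left _ _).trans hi
  rw [lintegral_congr hsup, lintegral_iSup (fun n => hc.measurable.min measurable_const)
    (fun m n hmn x => min_le_min_left _ (by exact_mod_cast hmn))]
  exact iSup_le hle

/-- Couplings of bounded cost, with second marginals that converge in `τ_q`, have a weak limit along
any ultrafilter, and the limit satisfies the same bound. -/
theorem exists_coupling_tendsto (hΩ : IsClosed Ω) {q : ℕ} (hq : q ≠ 0) {ι : Type*}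
    (F : Ultrafilter ι) {μs νs : ι → ProbabilityMeasure Ω} {ν : ProbabilityMeasure Ω}
    (hν : Tendsto νs F (@nhds _ (tau Ω q) ν)) (hmoms : ∀ i, HasFiniteMoment q (νs i))
    (hmom : HasFiniteMoment q ν) {C : ℝ≥0∞} (hC : C ≠ ∞)
    (h : ∀ᶠ i in (F : Filter ι), ∃ π ∈ couplings (μs i) (νs i), ∫⁻ z, edist z.1 z.2 ^ q ∂π < C) :
    ∃ μ, Tendsto μs F (𝓝 μ) ∧ ∃ π ∈ couplings μ ν, ∫⁻ z, edist z.1 z.2 ^ q ∂π ≤ C := by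
  obtain ⟨M, hMtop, hMs⟩ : ∃ M, M ≠ ∞ ∧ ∀ᶠ i in (F : Filter ι),
      ∫⁻ y : Ω, ‖(y : EuclideanSpace ℝ (Fin d))‖ₑ ^ q ∂(νs i : Measure Ω) < M := by
    have hM := hasFiniteMoment_iff.1 hmom
    exact ⟨_, ENNReal.add_ne_top.2 ⟨hM, ENNReal.one_ne_top⟩,
      (tendsto_lintegral_of_tendsto_tau hν hmoms hmom (by fun_prop) ENNReal.one_ne_top
        fun y => by rw [one_mul]; exact le_add_self).eventually_lt_const
        (ENNReal.lt_add_right hM one_ne_zero)⟩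
  -- Choose near-optimal couplings; their moments are eventually bounded.
  have hsel : ∃ πs : ι → ProbabilityMeasure (Ω × Ω), ∀ᶠ i in (F : Filter ι),
      (πs i : Measure (Ω × Ω)) ∈ couplings (μs i) (νs i) ∧
        ∫⁻ z, edist z.1 z.2 ^ q ∂(πs i : Measure (Ω × Ω)) < C := by
    have : ∀ i, ∃ π : ProbabilityMeasure (Ω × Ω),
        (∃ π ∈ couplings (μs i) (νs i), ∫⁻ z, edist z.1 z.2 ^ q ∂π < C) →
        (π : Measure (Ω × Ω)) ∈ couplings (μs i) (νs i) ∧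
        ∫⁻ z, edist z.1 z.2 ^ q ∂(π : Measure (Ω × Ω)) < C := by
      intro i
      by_cases hi : ∃ π ∈ couplings (μs i) (νs i), ∫⁻ z, edist z.1 z.2 ^ q ∂π < C
      · obtain ⟨π, hπ, hlt⟩ := hi
        exact ⟨⟨π, isProbabilityMeasure_of_mem_couplings hπ⟩, fun _ => ⟨hπ, hlt⟩⟩
      · exact ⟨(μs i).prod (νs i), fun h => absurd h hi⟩
    choose πs hπs using this
    exact ⟨πs, h.mono fun i hi => hπs i hi⟩
  obtain ⟨πs, hπs⟩ := hsel
  obtain ⟨B, hB, hBtop⟩ : ∃ B, B = 2 ^ q * (C + M) + M ∧ B ≠ ∞ :=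
    ⟨_, rfl, by finiteness⟩
  have hbound : ∀ᶠ i in (F : Filter ι),
      ∫⁻ z : Ω × Ω, (‖(z.1 : EuclideanSpace ℝ (Fin d))‖ₑ ^ q +
        ‖(z.2 : EuclideanSpace ℝ (Fin d))‖ₑ ^ q) ∂(πs i : Measure (Ω × Ω)) ≤ B := by
    filter_upwards [hπs, hMs] with i hi hMi
    have h2 : ∫⁻ z : Ω × Ω, ‖(z.2 : EuclideanSpace ℝ (Fin d))‖ₑ ^ q ∂(πs i : Measure (Ω × Ω)) ≤
        M :=
      (lintegral_snd_of_mem_couplings hi.1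
        (f := fun y => ‖(y : EuclideanSpace ℝ (Fin d))‖ₑ ^ q) (by fun_prop)).trans_le hMi.le
    rw [lintegral_add_left (by fun_prop), hB]
    refine add_le_add ?_ h2
    calc ∫⁻ z : Ω × Ω, ‖(z.1 : EuclideanSpace ℝ (Fin d))‖ₑ ^ q ∂(πs i : Measure (Ω × Ω))
        ≤ ∫⁻ z : Ω × Ω, 2 ^ q * (edist z.1 z.2 ^ q + ‖(z.2 : EuclideanSpace ℝ (Fin d))‖ₑ ^ q)
          ∂(πs i : Measure (Ω × Ω)) := lintegral_mono fun z => enorm_pow_le q z.1 z.2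
      _ = 2 ^ q * (∫⁻ z, edist z.1 z.2 ^ q ∂(πs i : Measure (Ω × Ω)) +
          ∫⁻ z : Ω × Ω, ‖(z.2 : EuclideanSpace ℝ (Fin d))‖ₑ ^ q ∂(πs i : Measure (Ω × Ω))) := by
        rw [lintegral_const_mul _ (by fun_prop), lintegral_add_left (by fun_prop)]
      _ ≤ 2 ^ q * (C + M) := mul_le_mul_right (add_le_add hi.2.le h2) _
  have hcomp := isCompact_closure_of_isTightMeasureSet
    (S := {π : ProbabilityMeasure (Ω × Ω) | ∫⁻ z : Ω × Ω,
      (‖(z.1 : EuclideanSpace ℝ (Fin d))‖ₑ ^ q +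
        ‖(z.2 : EuclideanSpace ℝ (Fin d))‖ₑ ^ q) ∂(π : Measure (Ω × Ω)) ≤ B})
    ((isTightMeasureSet_of_lintegral_le (by fun_prop)
      (fun r hr => isCompact_setOf_enorm_pow_add_le hΩ hq hr) hBtop).subset (by
        rintro _ ⟨π, hπ, rfl⟩; exact hπ))
  obtain ⟨π, -, hπ⟩ := hcomp.ultrafilter_le_nhds (F.map πs)
    (le_principal_iff.2 (hbound.mono fun i hi => subset_closure hi))
  replace hπ : Tendsto πs F (𝓝 π) := hπ
  have hfst := ProbabilityMeasure.tendsto_map_of_tendsto_of_continuous _ _ hπ continuous_fst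
  have hsnd := ProbabilityMeasure.tendsto_map_of_tendsto_of_continuous _ _ hπ continuous_snd
  have e1 : ∀ᶠ i in (F : Filter ι), (πs i).map continuous_fst.measurable.aemeasurable = μs i :=
    hπs.mono fun i hi => Subtype.ext hi.1.1
  have e2 : ∀ᶠ i in (F : Filter ι), (πs i).map continuous_snd.measurable.aemeasurable = νs i :=
    hπs.mono fun i hi => Subtype.ext hi.1.2
  refine ⟨_, hfst.congr' e1, π, ⟨rfl, ?_⟩, ?_⟩
  · exact congrArg (fun m : ProbabilityMeasure Ω => (m : Measure Ω))
      (tendsto_nhds_unique (hsnd.congr' e2) (tendsto_of_tendsto_tau hν))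
  · exact lintegral_le_of_tendsto hπ (by fun_prop) (hπs.mono fun i hi => hi.2.le)

/-- The graph of the ball correspondence is closed, and bounded enough for limits to exist: if the
centres converge in `τ_q` along an ultrafilter, then points of the balls converge weakly to a point
of the limiting ball. -/
theorem exists_tendsto_mem_wassersteinBall (hΩ : IsClosed Ω) {q : ℕ} (hq : q ≠ 0) {ε : ℝ}
    {ι : Type*} (F : Ultrafilter ι) {μs νs : ι → ProbabilityMeasure Ω} {ν : ProbabilityMeasure Ω}
    (hν : Tendsto νs F (@nhds _ (tau Ω q) ν)) (hmoms : ∀ i, HasFiniteMoment q (νs i))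
    (hmom : HasFiniteMoment q ν)
    (h : ∀ᶠ i in (F : Filter ι), μs i ∈ wassersteinBall q ε (νs i)) :
    ∃ μ ∈ wassersteinBall q ε ν, Tendsto μs F (𝓝 μ) := by
  have key : ∀ C, ENNReal.ofReal ε ^ q < C → C ≠ ∞ → ∃ μ, Tendsto μs F (𝓝 μ) ∧
      ∃ π ∈ couplings μ ν, ∫⁻ z, edist z.1 z.2 ^ q ∂π ≤ C := fun C hC hC' =>
    exists_coupling_tendsto hΩ hq F hν hmoms hmom hC'
      (h.mono fun i hi => (mem_wassersteinBall_iff hq).1 hi C hC)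
  have hε : ENNReal.ofReal ε ^ q ≠ ∞ := by finiteness
  obtain ⟨μ, hμ, -⟩ := key (ENNReal.ofReal ε ^ q + 1) (ENNReal.lt_add_right hε one_ne_zero)
    (by finiteness)
  refine ⟨μ, (mem_wassersteinBall_iff hq).2 fun C hC => ?_, hμ⟩
  obtain ⟨C', h1, h2⟩ := exists_between hC
  obtain ⟨μ', hμ', π, hπ, hle⟩ := key C' h1 h2.ne_top
  obtain rfl := tendsto_nhds_unique hμ hμ'
  exact ⟨π, hπ, hle.trans_lt h2⟩

/-! ### Couplings that depend continuously on their second marginal -/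

variable {ι : Type*} [Fintype ι]

theorem le_one_of_sum_eq_one {X : Type*} {ψ : ι → X → ℝ≥0} (hsum : ∀ y, ∑ i, ψ i y = 1) (i : ι)
    (y : X) : ψ i y ≤ 1 := by
  rw [← hsum y]
  exact Finset.single_le_sum (f := fun i => ψ i y) (fun _ _ => zero_le) (Finset.mem_univ i)

/-- For weights `ψ i` that add up to `1` and probability measures `κ i`, the law of `(x, y)` when
`y` has law `ρ`, the index `i` is chosen with probability `ψ i y`, and `x` has law `κ i`,
conditionally independent of `y` given `i`. Thus it is a coupling of `∑ i, ρ(ψ i) κ i` and `ρ`. -/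
noncomputable def mixCoupling (ψ : ι → Ω → ℝ≥0) (κ : ι → ProbabilityMeasure Ω)
    (ρ : ProbabilityMeasure Ω) : Measure (Ω × Ω) :=
  ∑ i, (κ i : Measure Ω).prod ((ρ : Measure Ω).withDensity fun y => ψ i y)

theorem lintegral_mixCoupling {ψ : ι → Ω → ℝ≥0} (hψ : ∀ i, Continuous (ψ i))
    (κ : ι → ProbabilityMeasure Ω) (ρ : ProbabilityMeasure Ω) {c : Ω × Ω → ℝ≥0∞}
    (hc : Measurable c) :
    ∫⁻ z, c z ∂(mixCoupling ψ κ ρ) =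
      ∑ i, ∫⁻ y, ψ i y * ∫⁻ x, c (x, y) ∂(κ i : Measure Ω) ∂(ρ : Measure Ω) := by
  rw [mixCoupling, lintegral_finsetSum_measure]
  refine Finset.sum_congr rfl fun i _ => ?_
  rw [lintegral_prod_symm' _ hc, lintegral_withDensity_eq_lintegral_mul _
    (by have := hψ i; fun_prop) hc.lintegral_prod_left']
  rfl

theorem map_snd_mixCoupling {ψ : ι → Ω → ℝ≥0} (hψ : ∀ i, Continuous (ψ i))
    (hsum : ∀ y, ∑ i, ψ i y = 1) (κ : ι → ProbabilityMeasure Ω) (ρ : ProbabilityMeasure Ω) :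
    (mixCoupling ψ κ ρ).map Prod.snd = ρ := by
  refine Measure.ext_of_lintegral _ fun f hf => ?_
  have hm : ∀ i, Measurable (ψ i) := fun i => (hψ i).measurable
  rw [lintegral_map hf measurable_snd,
    lintegral_mixCoupling hψ κ ρ (c := fun z => f z.2) (by fun_prop)]
  simp only [lintegral_const, measure_univ, mul_one]
  rw [← lintegral_finsetSum _ (fun i _ => by fun_prop)]
  refine lintegral_congr fun y => ?_
  rw [← Finset.sum_mul, ← ENNReal.ofNNReal_finsetSum, hsum, ENNReal.coe_one, one_mul]

theorem lintegral_fst_mixCoupling {ψ : ι → Ω → ℝ≥0} (hψ : ∀ i, Continuous (ψ i))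
    (κ : ι → ProbabilityMeasure Ω) (ρ : ProbabilityMeasure Ω) {f : Ω → ℝ≥0∞}
    (hf : Measurable f) :
    ∫⁻ x, f x ∂((mixCoupling ψ κ ρ).map Prod.fst) =
      ∑ i, (∫⁻ y, ψ i y ∂(ρ : Measure Ω)) * ∫⁻ x, f x ∂(κ i : Measure Ω) := by
  have hm : ∀ i, Measurable (ψ i) := fun i => (hψ i).measurable
  rw [lintegral_map hf measurable_fst,
    lintegral_mixCoupling hψ κ ρ (c := fun z => f z.1) (by fun_prop)]
  exact Finset.sum_congr rfl fun i _ => lintegral_mul_const (∫⁻ x, f x ∂(κ i : Measure Ω))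
    (hm i).coe_nnreal_ennreal

theorem isProbabilityMeasure_mixCoupling {ψ : ι → Ω → ℝ≥0} (hψ : ∀ i, Continuous (ψ i))
    (hsum : ∀ y, ∑ i, ψ i y = 1) (κ : ι → ProbabilityMeasure Ω) (ρ : ProbabilityMeasure Ω) :
    IsProbabilityMeasure (mixCoupling ψ κ ρ) := by
  have h : IsProbabilityMeasure ((mixCoupling ψ κ ρ).map Prod.snd) := by
    rw [map_snd_mixCoupling hψ hsum]; infer_instance
  exact (Measure.isProbabilityMeasure_map_iff measurable_snd.aemeasurable).1 h

theorem tendsto_lintegral_partition {ψ : ι → Ω → ℝ≥0} (hψ : ∀ i, Continuous (ψ i))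
    (hsum : ∀ y, ∑ i, ψ i y = 1) {α : Type*} {l : Filter α} {νs : α → ProbabilityMeasure Ω}
    {ν : ProbabilityMeasure Ω} (h : Tendsto νs l (𝓝 ν)) (i : ι) :
    Tendsto (fun j => ∫⁻ y, ψ i y ∂(νs j : Measure Ω)) l
      (𝓝 (∫⁻ y, ψ i y ∂(ν : Measure Ω))) := by
  have hle : ∀ y, ψ i y ≤ 1 := le_one_of_sum_eq_one hsum i
  have hb : ∀ x y, dist (ψ i x) (ψ i y) ≤ 1 := fun x y => by
    rw [NNReal.dist_eq]
    exact abs_sub_le_of_nonneg_of_le (NNReal.coe_nonneg _) (by exact_mod_cast hle x)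
      (NNReal.coe_nonneg _) (by exact_mod_cast hle y)
  exact ProbabilityMeasure.tendsto_iff_forall_lintegral_tendsto.1 h
    (BoundedContinuousFunction.mkOfBound ⟨ψ i, hψ i⟩ 1 hb)

/-- The first marginal of `mixCoupling ψ κ ρ` depends weakly continuously on `ρ`. -/
theorem tendsto_fst_mixCoupling {ψ : ι → Ω → ℝ≥0} (hψ : ∀ i, Continuous (ψ i))
    (hsum : ∀ y, ∑ i, ψ i y = 1) (κ : ι → ProbabilityMeasure Ω) {α : Type*} {l : Filter α}
    {νs : α → ProbabilityMeasure Ω} {ν : ProbabilityMeasure Ω} (h : Tendsto νs l (𝓝 ν))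
    {μs : α → ProbabilityMeasure Ω} {μ : ProbabilityMeasure Ω}
    (hμs : ∀ j, (μs j : Measure Ω) = (mixCoupling ψ κ (νs j)).map Prod.fst)
    (hμ : (μ : Measure Ω) = (mixCoupling ψ κ ν).map Prod.fst) :
    Tendsto μs l (𝓝 μ) := by
  refine ProbabilityMeasure.tendsto_iff_forall_lintegral_tendsto.2 fun f => ?_
  have hf : Measurable fun x => (f x : ℝ≥0∞) := by
    have := f.continuous.measurable
    fun_prop
  simp only [hμs, hμ, lintegral_fst_mixCoupling hψ _ _ hf]
  refine tendsto_finsetSum _ fun i _ => ?_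
  refine ENNReal.Tendsto.mul_const (tendsto_lintegral_partition hψ hsum h i) (Or.inr ?_)
  exact (f.lintegral_lt_top_of_nnreal _).ne

theorem lintegral_edist_pow_le {q : ℕ} (κ : ProbabilityMeasure Ω) (y : Ω) :
    ∫⁻ x, edist x y ^ q ∂(κ : Measure Ω) ≤
      2 ^ q * (∫⁻ x : Ω, ‖(x : EuclideanSpace ℝ (Fin d))‖ₑ ^ q ∂(κ : Measure Ω) +
        ‖(y : EuclideanSpace ℝ (Fin d))‖ₑ ^ q) := by
  calc ∫⁻ x, edist x y ^ q ∂(κ : Measure Ω)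
      ≤ ∫⁻ x : Ω, 2 ^ q * (‖(x : EuclideanSpace ℝ (Fin d))‖ₑ ^ q +
        ‖(y : EuclideanSpace ℝ (Fin d))‖ₑ ^ q) ∂(κ : Measure Ω) :=
        lintegral_mono fun x => edist_pow_le q x y
    _ = _ := by
      rw [lintegral_const_mul _ (by fun_prop), lintegral_add_left (by fun_prop)]
      simp

theorem continuous_lintegral_edist_pow {q : ℕ} {κ : ProbabilityMeasure Ω}
    (hκ : HasFiniteMoment q κ) :
    Continuous fun y => ∫⁻ x, edist x y ^ q ∂(κ : Measure Ω) := by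
  refine continuous_iff_continuousAt.2 fun y₀ => ?_
  refine tendsto_lintegral_filter_of_dominated_convergence
    (fun x : Ω => 2 ^ q * (‖(x : EuclideanSpace ℝ (Fin d))‖ₑ ^ q +
      (‖(y₀ : EuclideanSpace ℝ (Fin d))‖ₑ ^ q + 1)))
    (Eventually.of_forall fun y => by fun_prop) ?_ ?_ ?_
  · have hy : ∀ᶠ y : Ω in 𝓝 y₀, ‖(y : EuclideanSpace ℝ (Fin d))‖ₑ ^ q <
        ‖(y₀ : EuclideanSpace ℝ (Fin d))‖ₑ ^ q + 1 := by
      have hc : Continuous fun y : Ω => ‖(y : EuclideanSpace ℝ (Fin d))‖ₑ ^ q := by fun_prop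
      exact hc.continuousAt.eventually_lt_const (ENNReal.lt_add_right (by finiteness) one_ne_zero)
    filter_upwards [hy] with y hy
    refine ae_of_all _ fun x => (edist_pow_le q x y).trans ?_
    gcongr
  · have := hasFiniteMoment_iff.1 hκ
    rw [lintegral_const_mul _ (by fun_prop), lintegral_add_left (by fun_prop)]
    simp only [lintegral_const, measure_univ, mul_one]
    finiteness
  · refine ae_of_all _ fun x => ?_
    have hc : Continuous fun y => edist x y ^ q := by fun_prop
    exact hc.continuousAt

/-- The cost of `mixCoupling ψ κ ρ` depends `τ_q`-continuously on `ρ`, being the integral of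
`∑ i, ψ i y * ∫⁻ x, edist x y ^ q ∂(κ i)`, a continuous function with growth of degree `q`. -/
theorem tendsto_lintegral_mixCoupling {q : ℕ} {ψ : ι → Ω → ℝ≥0} (hψ : ∀ i, Continuous (ψ i))
    (hsum : ∀ y, ∑ i, ψ i y = 1) {κ : ι → ProbabilityMeasure Ω}
    (hκ : ∀ i, HasFiniteMoment q (κ i)) {α : Type*} {l : Filter α}
    {νs : α → ProbabilityMeasure Ω} {ν : ProbabilityMeasure Ω}
    (h : Tendsto νs l (@nhds _ (tau Ω q) ν)) (hνs : ∀ j, HasFiniteMoment q (νs j))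
    (hν : HasFiniteMoment q ν) :
    Tendsto (fun j => ∫⁻ z, edist z.1 z.2 ^ q ∂(mixCoupling ψ κ (νs j))) l
      (𝓝 (∫⁻ z, edist z.1 z.2 ^ q ∂(mixCoupling ψ κ ν))) := by
  have hm : Measurable fun z : Ω × Ω => edist z.1 z.2 ^ q := by fun_prop
  simp only [lintegral_mixCoupling hψ _ _ hm]
  refine tendsto_finsetSum _ fun i _ => ?_
  have hmom := hasFiniteMoment_iff.1 (hκ i)
  have hle : ∀ y, ψ i y ≤ 1 := le_one_of_sum_eq_one hsum i
  refine tendsto_lintegral_of_tendsto_tau h hνs hν ?_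
    (C := 2 ^ q * (∫⁻ x : Ω, ‖(x : EuclideanSpace ℝ (Fin d))‖ₑ ^ q ∂(κ i : Measure Ω) + 1))
    (by finiteness) fun y => ?_
  · refine continuous_iff_continuousAt.2 fun y => ENNReal.Tendsto.mul
      (ENNReal.continuous_coe.comp (hψ i)).continuousAt (Or.inr ?_)
      (continuous_lintegral_edist_pow (hκ i)).continuousAt (Or.inr ENNReal.coe_ne_top)
    exact ne_top_of_le_ne_top (by finiteness) (lintegral_edist_pow_le (κ i) y)
  · refine (mul_le_of_le_one_left zero_le (by exact_mod_cast hle y)).trans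
      ((lintegral_edist_pow_le (κ i) y).trans ?_)
    rw [mul_assoc]
    gcongr
    set m := ∫⁻ x : Ω, ‖(x : EuclideanSpace ℝ (Fin d))‖ₑ ^ q ∂(κ i : Measure Ω)
    set t := ‖(y : EuclideanSpace ℝ (Fin d))‖ₑ ^ q
    calc m + t ≤ (m + t) + (m * t + 1) := le_self_add
      _ = (m + 1) * (1 + t) := by ring

/-! ### Partitions of unity of small mesh -/

/-- A finite continuous partition of unity on `Ω` each of whose members is supported either in a set
of diameter at most `δ` or outside the ball of radius `R`. -/
theorem exists_partition (hΩ : IsClosed Ω) {δ : ℝ} (hδ : 0 < δ) (R : ℝ) :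
    ∃ (ι : Type) (_ : Fintype ι) (ψ : ι → Ω → ℝ≥0), (∀ i, Continuous (ψ i)) ∧
      (∀ y, ∑ i, ψ i y = 1) ∧ ∀ i y y', ψ i y ≠ 0 → ψ i y' ≠ 0 →
        dist y y' ≤ δ ∨ (R < ‖(y : EuclideanSpace ℝ (Fin d))‖ ∧
          R < ‖(y' : EuclideanSpace ℝ (Fin d))‖) := by
  classical
  have hK : IsCompact ((Subtype.val : Ω → EuclideanSpace ℝ (Fin d)) ⁻¹'
      Metric.closedBall 0 R) :=
    hΩ.isClosedEmbedding_subtypeVal.isCompact_preimage (isCompact_closedBall _ _)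
  obtain ⟨t, ht⟩ := hK.elim_finite_subcover (fun c : Ω => Metric.ball c (δ / 2))
    (fun _ => Metric.isOpen_ball)
    (fun y _ => Set.mem_iUnion.2 ⟨y, Metric.mem_ball_self (half_pos hδ)⟩)
  -- Bumps around the centres, and one function that is positive exactly outside the `R`-ball.
  let f : Option t → Ω → ℝ≥0 := fun i y => match i with
    | none => (‖(y : EuclideanSpace ℝ (Fin d))‖ - R).toNNReal
    | some c => (δ / 2 - dist y c.1).toNNReal
  have hf : ∀ i, Continuous (f i) := by
    rintro (_ | c)
    · exact continuous_real_toNNReal.comp (by fun_prop)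
    · exact continuous_real_toNNReal.comp (by fun_prop)
  have hpos : ∀ y, ∑ i, f i y ≠ 0 := by
    intro y h0
    rw [Finset.sum_eq_zero_iff] at h0
    by_cases hy : ‖(y : EuclideanSpace ℝ (Fin d))‖ ≤ R
    · have hy' := ht (show y ∈ _ from mem_closedBall_zero_iff.2 hy)
      simp only [Set.mem_iUnion, Metric.mem_ball, exists_prop] at hy'
      obtain ⟨c, hc, hyc⟩ := hy'
      have := h0 (some ⟨c, hc⟩) (Finset.mem_univ _)
      simp only [f, Real.toNNReal_eq_zero] at this
      linarith
    · have := h0 none (Finset.mem_univ _)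
      simp only [f, Real.toNNReal_eq_zero] at this
      linarith
  refine ⟨Option t, inferInstance, fun i y => f i y / ∑ j, f j y, fun i => ?_, fun y => ?_, ?_⟩
  · exact (hf i).div (continuous_finsetSum _ fun j _ => hf j) hpos
  · rw [← Finset.sum_div, div_self (hpos y)]
  · intro i y y' hy hy'
    replace hy := (div_ne_zero_iff.1 hy).1
    replace hy' := (div_ne_zero_iff.1 hy').1
    rcases i with _ | c
    · right
      simp only [f, ne_eq, Real.toNNReal_eq_zero, not_le] at hy hy'
      constructor <;> linarith
    · left
      simp only [f, ne_eq, Real.toNNReal_eq_zero, not_le] at hy hy'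
      have := dist_triangle_right y y' c.1
      linarith

/-! ### Approximation of a coupling -/

section Glue

variable {X : Type*} [MeasurableSpace X]

/-- The density `∑ i, (∫ ψ i dν)⁻¹ ψ i y ψ i y'` of `glue`, at `((x, y), y')`. Indices `i` with
`∫ ψ i dν = 0`, for which the inverse is `∞`, are harmless: there `ψ i = 0` holds `ν`-a.e. -/
noncomputable def glueDensity (ψ : ι → X → ℝ≥0) (ν : Measure X) (p : (X × X) × X) : ℝ≥0∞ :=
  ∑ i, (∫⁻ y, ψ i y ∂ν)⁻¹ * (ψ i p.1.2 * ψ i p.2)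

theorem measurable_glueDensity {ψ : ι → X → ℝ≥0} (hψ : ∀ i, Measurable (ψ i)) (ν : Measure X) :
    Measurable (glueDensity ψ ν) :=
  Finset.measurable_fun_sum _ fun i _ => by fun_prop

/-- The case `∫ ψ dν = 0` is included, since then `ψ = 0` almost everywhere. -/
theorem inv_mul_mul_ae_eq {ψ : X → ℝ≥0} (hψ : Measurable ψ) (hle : ∀ y, ψ y ≤ 1)
    (ν : Measure X) [IsProbabilityMeasure ν] :
    ∀ᵐ y ∂ν, (∫⁻ y, ψ y ∂ν)⁻¹ * ((∫⁻ y, ψ y ∂ν) * ψ y) = ψ y := by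
  by_cases h0 : ∫⁻ y, ψ y ∂ν = 0
  · filter_upwards [(lintegral_eq_zero_iff (by fun_prop)).1 h0] with y hy
    rw [show (ψ y : ℝ≥0∞) = 0 from hy]
    simp
  · have htop : ∫⁻ y, ψ y ∂ν ≠ ∞ := by
      refine ne_top_of_le_ne_top ENNReal.one_ne_top
        ((lintegral_mono fun y => ENNReal.coe_le_coe.2 (hle y)).trans ?_)
      simp
    refine ae_of_all _ fun y => ?_
    rw [← mul_assoc, ENNReal.inv_mul_cancel h0 htop, one_mul]

theorem sum_inv_mul_mul_ae_eq_one {ψ : ι → X → ℝ≥0} (hψ : ∀ i, Measurable (ψ i))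
    (hsum : ∀ y, ∑ i, ψ i y = 1) (ν : Measure X) [IsProbabilityMeasure ν] :
    ∀ᵐ y ∂ν, ∑ i, (∫⁻ y, ψ i y ∂ν)⁻¹ * ((∫⁻ y, ψ i y ∂ν) * ψ i y) = 1 := by
  have h : ∀ i, ∀ᵐ y ∂ν, (∫⁻ y, ψ i y ∂ν)⁻¹ * ((∫⁻ y, ψ i y ∂ν) * ψ i y) = ψ i y := fun i =>
    inv_mul_mul_ae_eq (hψ i) (fun y => le_one_of_sum_eq_one hsum i y) ν
  filter_upwards [eventually_all.2 h] with y hy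
  rw [Finset.sum_congr rfl fun i _ => hy i, ← ENNReal.ofNNReal_finsetSum, hsum, ENNReal.coe_one]

/-- For a coupling `π` with second marginal `ν`, the law of `((x, y), y')` when `(x, y)` has law
`π`, the index `i` is chosen with probability `ψ i y`, and `y'` has law `ψ i ν`, normalized,
conditionally independent of `(x, y)` given `i`.
Its marginals in `(x, y)` and `y'` are `π` and `ν`, and `y` and `y'` lie in the support of the same
`ψ i`. -/
noncomputable def glue (ψ : ι → X → ℝ≥0) (π : Measure (X × X)) (ν : Measure X) :
    Measure ((X × X) × X) :=
  (π.prod ν).withDensity (glueDensity ψ ν)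

variable {ψ : ι → X → ℝ≥0} {π : Measure (X × X)} {ν : Measure X}

theorem lintegral_glue_fst [IsProbabilityMeasure ν] (hψ : ∀ i, Measurable (ψ i))
    (hsum : ∀ y, ∑ i, ψ i y = 1) (hπ : π.map Prod.snd = ν) {f : X × X → ℝ≥0∞} (hf : Measurable f) :
    ∫⁻ p, f p.1 ∂(glue ψ π ν) = ∫⁻ z, f z ∂π := by
  have hw := measurable_glueDensity hψ ν
  rw [glue, lintegral_withDensity_eq_lintegral_mul _ hw (by fun_prop),
    lintegral_prod _ (by fun_prop)]
  have hae := sum_inv_mul_mul_ae_eq_one hψ hsum ν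
  rw [← hπ] at hae
  refine lintegral_congr_ae ?_
  filter_upwards [ae_of_ae_map measurable_snd.aemeasurable hae] with z hz
  rw [hπ] at hz
  simp only [Pi.mul_apply]
  rw [lintegral_mul_const _ (by fun_prop)]
  have : ∫⁻ y, glueDensity ψ ν (z, y) ∂ν = 1 := by
    rw [← hz]
    simp only [glueDensity]
    rw [lintegral_finsetSum _ fun i _ => by fun_prop]
    refine Finset.sum_congr rfl fun i _ => ?_
    rw [lintegral_const_mul _ (by fun_prop), lintegral_const_mul _ (by fun_prop),
      mul_comm (ψ i z.2 : ℝ≥0∞)]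
  rw [this, one_mul]

theorem lintegral_glue_snd [IsProbabilityMeasure π] [IsProbabilityMeasure ν]
    (hψ : ∀ i, Measurable (ψ i)) (hsum : ∀ y, ∑ i, ψ i y = 1) (hπ : π.map Prod.snd = ν)
    {f : X → ℝ≥0∞} (hf : Measurable f) :
    ∫⁻ p, f p.2 ∂(glue ψ π ν) = ∫⁻ y, f y ∂ν := by
  have hw := measurable_glueDensity hψ ν
  rw [glue, lintegral_withDensity_eq_lintegral_mul _ hw (by fun_prop),
    lintegral_prod_symm' _ (by fun_prop)]
  refine lintegral_congr_ae ?_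
  filter_upwards [sum_inv_mul_mul_ae_eq_one hψ hsum ν] with y hy
  simp only [Pi.mul_apply]
  rw [lintegral_mul_const _ (by fun_prop)]
  have : ∫⁻ z, glueDensity ψ ν (z, y) ∂π = 1 := by
    rw [← hy]
    simp only [glueDensity]
    rw [lintegral_finsetSum _ fun i _ => by fun_prop]
    refine Finset.sum_congr rfl fun i _ => ?_
    rw [lintegral_const_mul _ (by fun_prop), lintegral_mul_const _ (by fun_prop), ← hπ,
      lintegral_map (by fun_prop) measurable_snd]
  rw [this, one_mul]

theorem ae_glue {P : (X × X) × X → Prop} (hψ : ∀ i, Measurable (ψ i))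
    (h : ∀ i p, ψ i p.1.2 ≠ 0 → ψ i p.2 ≠ 0 → P p) : ∀ᵐ p ∂(glue ψ π ν), P p := by
  rw [glue, ae_withDensity_iff (measurable_glueDensity hψ ν)]
  refine ae_of_all _ fun p hp => ?_
  obtain ⟨i, -, hi⟩ := Finset.exists_ne_zero_of_sum_ne_zero hp
  have hi' := right_ne_zero_of_mul hi
  exact h i p (by simpa using left_ne_zero_of_mul hi') (by simpa using right_ne_zero_of_mul hi')

end Glue

/-- The law `κ` of `x` under `π` conditioned with the weight `ψ y`. If the weight has integral `0`,
any measure with a finite moment will do, and `μ` is used. -/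
theorem exists_conditional_law {q : ℕ} {μ ν : ProbabilityMeasure Ω} (hμ : HasFiniteMoment q μ)
    {π : Measure (Ω × Ω)} (hπ : π ∈ couplings μ ν) {ψ : Ω → ℝ≥0} (hψ : Measurable ψ)
    (hle : ∀ y, ψ y ≤ 1) :
    ∃ κ : ProbabilityMeasure Ω, HasFiniteMoment q κ ∧ ∀ f : Ω → ℝ≥0∞, Measurable f →
      (∫⁻ y, ψ y ∂(ν : Measure Ω)) * ∫⁻ x, f x ∂(κ : Measure Ω) =
        ∫⁻ z, ψ z.2 * f z.1 ∂π := by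
  have := isProbabilityMeasure_of_mem_couplings hπ
  have ha : ∫⁻ z, ψ z.2 ∂π = ∫⁻ y, ψ y ∂(ν : Measure Ω) :=
    lintegral_snd_of_mem_couplings hπ (f := fun y => (ψ y : ℝ≥0∞)) (by fun_prop)
  by_cases h0 : ∫⁻ y, ψ y ∂(ν : Measure Ω) = 0
  · refine ⟨μ, hμ, fun f hf => ?_⟩
    rw [h0, zero_mul, eq_comm, lintegral_eq_zero_iff (by fun_prop)]
    rw [h0, lintegral_eq_zero_iff (by fun_prop)] at ha
    filter_upwards [ha] with z hz
    rw [show (ψ z.2 : ℝ≥0∞) = 0 from hz]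
    simp
  · set a := ∫⁻ y, ψ y ∂(ν : Measure Ω)
    have htop : a ≠ ∞ := by
      refine ne_top_of_le_ne_top ENNReal.one_ne_top
        ((lintegral_mono fun y => ENNReal.coe_le_coe.2 (hle y)).trans ?_)
      simp
    have hint : ∀ f : Ω → ℝ≥0∞, Measurable f →
        ∫⁻ x, f x ∂(a⁻¹ • (π.withDensity fun z => ψ z.2).map Prod.fst) =
          a⁻¹ * ∫⁻ z, ψ z.2 * f z.1 ∂π := by
      intro f hf
      rw [lintegral_smul_measure, lintegral_map hf measurable_fst,
        lintegral_withDensity_eq_lintegral_mul _ (by fun_prop) (by fun_prop)]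
      rfl
    have hprob : IsProbabilityMeasure
        (a⁻¹ • (π.withDensity fun z => (ψ z.2 : ℝ≥0∞)).map Prod.fst) := by
      constructor
      rw [← lintegral_one, hint _ measurable_const]
      simp only [mul_one]
      rw [ha, ENNReal.inv_mul_cancel h0 htop]
    obtain ⟨κ, hκ⟩ : ∃ κ : ProbabilityMeasure Ω, (κ : Measure Ω) =
        a⁻¹ • (π.withDensity fun z => (ψ z.2 : ℝ≥0∞)).map Prod.fst := ⟨⟨_, hprob⟩, rfl⟩
    rw [← hκ] at hint
    refine ⟨κ, ?_, fun f hf => ?_⟩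
    · rw [hasFiniteMoment_iff, hint _ (by fun_prop)]
      refine ENNReal.mul_ne_top (by simpa using h0) ?_
      have hm := hasFiniteMoment_iff.1 hμ
      rw [← lintegral_fst_of_mem_couplings hπ (by fun_prop)] at hm
      refine ne_top_of_le_ne_top hm (lintegral_mono fun z => ?_)
      exact mul_le_of_le_one_left zero_le (ENNReal.coe_le_one_iff.2 (hle z.2))
    · rw [hint f hf, ← mul_assoc, ENNReal.mul_inv_cancel h0 htop, one_mul]

/-- If the `κ i` are the conditional laws of `x` given the weights `ψ i y`, then `mixCoupling ψ κ ν`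
is the law of `(x, y')` under `glue ψ π ν`. -/
theorem lintegral_mixCoupling_eq_glue {ψ : ι → Ω → ℝ≥0} (hψ : ∀ i, Continuous (ψ i))
    (hsum : ∀ y, ∑ i, ψ i y = 1) {ν : ProbabilityMeasure Ω} {π : Measure (Ω × Ω)}
    [IsProbabilityMeasure π] {κ : ι → ProbabilityMeasure Ω}
    (hκ : ∀ i, ∀ f : Ω → ℝ≥0∞, Measurable f →
      (∫⁻ y, ψ i y ∂(ν : Measure Ω)) * ∫⁻ x, f x ∂(κ i : Measure Ω) =
        ∫⁻ z, ψ i z.2 * f z.1 ∂π) {c : Ω × Ω → ℝ≥0∞} (hc : Measurable c) :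
    ∫⁻ z, c z ∂(mixCoupling ψ κ ν) = ∫⁻ p, c (p.1.1, p.2) ∂(glue ψ π (ν : Measure Ω)) := by
  have hm : ∀ i, Measurable (ψ i) := fun i => (hψ i).measurable
  have hw := measurable_glueDensity hm (ν : Measure Ω)
  rw [lintegral_mixCoupling hψ _ _ hc, glue,
    lintegral_withDensity_eq_lintegral_mul _ hw (by fun_prop), lintegral_prod_symm' _ (by fun_prop),
    ← lintegral_finsetSum' _ fun i _ => by
      have := hc.lintegral_prod_left' (μ := (κ i : Measure Ω))
      fun_prop]
  have h : ∀ i, ∀ᵐ y ∂(ν : Measure Ω), (∫⁻ y, ψ i y ∂(ν : Measure Ω))⁻¹ *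
      ((∫⁻ y, ψ i y ∂(ν : Measure Ω)) * ψ i y) = ψ i y := fun i =>
    inv_mul_mul_ae_eq (hm i) (fun y => le_one_of_sum_eq_one hsum i y) _
  refine lintegral_congr_ae ?_
  filter_upwards [eventually_all.2 h] with y hy
  simp only [Pi.mul_apply, glueDensity, Finset.sum_mul]
  rw [lintegral_finsetSum _ fun i _ => by fun_prop]
  refine Finset.sum_congr rfl fun i _ => ?_
  set a := ∫⁻ y, ψ i y ∂(ν : Measure Ω)
  calc (ψ i y : ℝ≥0∞) * ∫⁻ x, c (x, y) ∂(κ i : Measure Ω)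
      = a⁻¹ * ψ i y * (a * ∫⁻ x, c (x, y) ∂(κ i : Measure Ω)) := by
        conv_lhs => rw [← hy i]
        ring
    _ = a⁻¹ * ψ i y * ∫⁻ z, ψ i z.2 * c (z.1, y) ∂π := by
        rw [hκ i (fun x => c (x, y)) (by fun_prop)]
    _ = ∫⁻ z, a⁻¹ * (ψ i z.2 * ψ i y) * c (z.1, y) ∂π := by
        rw [← lintegral_const_mul _ (by fun_prop)]
        exact lintegral_congr fun z => by ring

/-- Under `glue ψ π ν` the points `y` and `y'` are close to each other: up to the mesh `δ`, their
distance is controlled by the tail of the `q`-th moment of `ν`. -/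
theorem lintegral_glue_edist_pow_le {q : ℕ} {δ : ℝ} {R : ℝ} {ψ : ι → Ω → ℝ≥0}
    (hψ : ∀ i, Continuous (ψ i)) (hsum : ∀ y, ∑ i, ψ i y = 1)
    (hsupp : ∀ i y y', ψ i y ≠ 0 → ψ i y' ≠ 0 → dist y y' ≤ δ ∨
      (R < ‖(y : EuclideanSpace ℝ (Fin d))‖ ∧ R < ‖(y' : EuclideanSpace ℝ (Fin d))‖))
    {μ ν : ProbabilityMeasure Ω} {π : Measure (Ω × Ω)} (hπ : π ∈ couplings μ ν) :
    ∫⁻ p, edist p.1.2 p.2 ^ q ∂(glue ψ π (ν : Measure Ω)) ≤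
      ENNReal.ofReal δ ^ q + 2 ^ q * (2 * ∫⁻ y,
        {y : Ω | R < ‖(y : EuclideanSpace ℝ (Fin d))‖}.indicator
        (fun y => ‖(y : EuclideanSpace ℝ (Fin d))‖ₑ ^ q) y ∂(ν : Measure Ω)) := by
  have := isProbabilityMeasure_of_mem_couplings hπ
  have hm : ∀ i, Measurable (ψ i) := fun i => (hψ i).measurable
  set t : Ω → ℝ≥0∞ := {y : Ω | R < ‖(y : EuclideanSpace ℝ (Fin d))‖}.indicator
        (fun y => ‖(y : EuclideanSpace ℝ (Fin d))‖ₑ ^ q) with ht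
  have htm : Measurable t :=
    Measurable.indicator (by fun_prop) (measurableSet_lt (by fun_prop) (by fun_prop))
  have hae : ∀ᵐ p ∂(glue ψ π (ν : Measure Ω)), edist p.1.2 p.2 ^ q ≤
      ENNReal.ofReal δ ^ q + 2 ^ q * (t p.1.2 + t p.2) := by
    refine ae_glue hm fun i p h1 h2 => ?_
    rcases hsupp i _ _ h1 h2 with h | ⟨h, h'⟩
    · refine le_add_right (pow_le_pow_left' ?_ q)
      rw [edist_dist]
      exact ENNReal.ofReal_le_ofReal h
    · refine le_add_left ((edist_pow_le q _ _).trans_eq ?_)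
      rw [ht, Set.indicator_of_mem (by exact h), Set.indicator_of_mem (by exact h')]
  refine (lintegral_mono_ae hae).trans_eq ?_
  have e1 : ∫⁻ p, t p.1.2 ∂(glue ψ π (ν : Measure Ω)) = ∫⁻ y, t y ∂(ν : Measure Ω) :=
    (lintegral_glue_fst hm hsum hπ.2 (f := fun z => t z.2) (by fun_prop)).trans
      (lintegral_snd_of_mem_couplings hπ htm)
  have e2 : ∫⁻ p, t p.2 ∂(glue ψ π (ν : Measure Ω)) = ∫⁻ y, t y ∂(ν : Measure Ω) :=
    lintegral_glue_snd hm hsum hπ.2 htm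
  have e3 : ∫⁻ _, ENNReal.ofReal δ ^ q ∂(glue ψ π (ν : Measure Ω)) = ENNReal.ofReal δ ^ q :=
    (lintegral_glue_snd hm hsum hπ.2 (f := fun _ => ENNReal.ofReal δ ^ q) measurable_const).trans
      (by simp)
  rw [lintegral_add_left measurable_const, lintegral_const_mul _ (by fun_prop),
    lintegral_add_left (by fun_prop), e1, e2, e3, two_mul]

/-- A coupling `π` of `μ` and `ν` of cost `< C` can be replaced by one of the form
`mixCoupling ψ κ ν` with the same marginals and still of cost `< C`. -/
theorem exists_mixCoupling (hΩ : IsClosed Ω) {q : ℕ} (hq : q ≠ 0) {μ ν : ProbabilityMeasure Ω}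
    (hμ : HasFiniteMoment q μ) (hν : HasFiniteMoment q ν) {π : Measure (Ω × Ω)}
    (hπ : π ∈ couplings μ ν) {C : ℝ≥0∞} (hC : ∫⁻ z, edist z.1 z.2 ^ q ∂π < C) :
    ∃ (ι : Type) (_ : Fintype ι) (ψ : ι → Ω → ℝ≥0) (κ : ι → ProbabilityMeasure Ω),
      (∀ i, Continuous (ψ i)) ∧ (∀ y, ∑ i, ψ i y = 1) ∧ (∀ i, HasFiniteMoment q (κ i)) ∧
      (mixCoupling ψ κ ν).map Prod.fst = μ ∧
      ∫⁻ z, edist z.1 z.2 ^ q ∂(mixCoupling ψ κ ν) < C := by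
  have := isProbabilityMeasure_of_mem_couplings hπ
  have hq' : (0 : ℝ) < q := by positivity
  -- Room for the error in Minkowski's inequality.
  obtain ⟨η, hη, hηC⟩ : ∃ η : ℝ≥0∞, 0 < η ∧
      ((∫⁻ z, edist z.1 z.2 ^ q ∂π) ^ (1 / (q : ℝ)) + η ^ (1 / (q : ℝ))) < C ^ (1 / (q : ℝ)) := by
    have hcont : Tendsto (fun η : ℝ≥0∞ =>
        (∫⁻ z, edist z.1 z.2 ^ q ∂π) ^ (1 / (q : ℝ)) + η ^ (1 / (q : ℝ))) (𝓝[>] 0)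
        (𝓝 ((∫⁻ z, edist z.1 z.2 ^ q ∂π) ^ (1 / (q : ℝ)) + 0 ^ (1 / (q : ℝ)))) :=
      (Continuous.tendsto (by fun_prop) 0).mono_left nhdsWithin_le_nhds
    rw [ENNReal.zero_rpow_of_pos (by positivity), add_zero] at hcont
    have := (hcont.eventually_lt_const (ENNReal.rpow_lt_rpow hC (by positivity))).and
      self_mem_nhdsWithin
    obtain ⟨η, h1, h2⟩ := this.exists
    exact ⟨η, h2, h1⟩
  have hlim : Tendsto (fun n : ℕ => ENNReal.ofReal (1 / ((n : ℝ) + 1)) ^ q + 2 ^ q * (2 * ∫⁻ y,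
      {y : Ω | (n : ℝ) < ‖(y : EuclideanSpace ℝ (Fin d))‖}.indicator
        (fun y => ‖(y : EuclideanSpace ℝ (Fin d))‖ₑ ^ q) y ∂(ν : Measure Ω))) atTop (𝓝 0) := by
    have h1 : Tendsto (fun n : ℕ => ENNReal.ofReal (1 / ((n : ℝ) + 1)) ^ q) atTop (𝓝 0) := by
      have := ENNReal.Tendsto.pow (n := q)
        (ENNReal.tendsto_ofReal (tendsto_one_div_add_atTop_nhds_zero_nat (𝕜 := ℝ)))
      simpa [hq] using this
    have h2 : Tendsto (fun n : ℕ => ∫⁻ y,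
        {y : Ω | (n : ℝ) < ‖(y : EuclideanSpace ℝ (Fin d))‖}.indicator
        (fun y => ‖(y : EuclideanSpace ℝ (Fin d))‖ₑ ^ q) y ∂(ν : Measure Ω)) atTop
        (𝓝 (∫⁻ _, 0 ∂(ν : Measure Ω))) := by
      refine tendsto_lintegral_of_dominated_convergence
        (fun y : Ω => ‖(y : EuclideanSpace ℝ (Fin d))‖ₑ ^ q) (fun n => ?_) (fun n => ?_)
        (hasFiniteMoment_iff.1 hν) (ae_of_all _ fun y => ?_)
      · exact Measurable.indicator (by fun_prop) (measurableSet_lt (by fun_prop) (by fun_prop))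
      · exact ae_of_all _ fun y => Set.indicator_le_self _ _ y
      · refine tendsto_const_nhds.congr' ?_
        obtain ⟨N, hN⟩ := exists_nat_ge ‖(y : EuclideanSpace ℝ (Fin d))‖
        filter_upwards [eventually_ge_atTop N] with n hn
        refine (Set.indicator_of_notMem ?_ _).symm
        exact not_lt.2 (hN.trans (by exact_mod_cast hn))
    rw [lintegral_zero] at h2
    have h3 := ENNReal.Tendsto.const_mul (a := 2 ^ q)
      (ENNReal.Tendsto.const_mul (a := 2) h2 (Or.inr (by finiteness))) (Or.inr (by finiteness))
    simpa using h1.add h3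
  -- Mesh `1 / (n + 1)` and radius `n`, with `n` large enough for the error to be below `η`.
  obtain ⟨n, hn⟩ := (hlim.eventually_lt_const hη).exists
  obtain ⟨ι, hι, ψ, hψ, hsum, hsupp⟩ :=
    exists_partition hΩ (δ := 1 / ((n : ℝ) + 1)) (by positivity) (n : ℝ)
  have hm : ∀ i, Measurable (ψ i) := fun i => (hψ i).measurable
  choose κ hκmom hκ using fun i =>
    exists_conditional_law hμ hπ (hm i) (fun y => le_one_of_sum_eq_one hsum i y)
  refine ⟨ι, hι, ψ, κ, hψ, hsum, hκmom, ?_, ?_⟩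
  · refine Measure.ext_of_lintegral _ fun f hf => ?_
    rw [lintegral_fst_mixCoupling hψ _ _ hf, ← lintegral_fst_of_mem_couplings hπ hf,
      Finset.sum_congr rfl fun i _ => hκ i f hf, ← lintegral_finsetSum _ fun i _ => by fun_prop]
    refine lintegral_congr fun z => ?_
    rw [← Finset.sum_mul, ← ENNReal.ofNNReal_finsetSum, hsum, ENNReal.coe_one, one_mul]
  · rw [lintegral_mixCoupling_eq_glue hψ hsum hκ (by fun_prop)]
    have h1 := lintegral_glue_fst (ψ := ψ) hm hsum hπ.2 (f := fun z => edist z.1 z.2 ^ q)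
      (by fun_prop)
    have h2 := (lintegral_glue_edist_pow_le (q := q) hψ hsum hsupp hπ).trans_lt hn
    have hmink := ENNReal.lintegral_Lp_add_le (μ := glue ψ π (ν : Measure Ω)) (p := q)
      (f := fun p => edist p.1.1 p.1.2) (g := fun p => edist p.1.2 p.2) (by fun_prop) (by fun_prop)
      (by exact_mod_cast Nat.one_le_iff_ne_zero.2 hq)
    simp only [ENNReal.rpow_natCast, Pi.add_apply] at hmink
    rw [h1] at hmink
    refine (ENNReal.rpow_lt_rpow_iff (z := 1 / (q : ℝ)) (by positivity)).1 (lt_of_le_of_lt ?_ hηC)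
    calc (∫⁻ p, edist p.1.1 p.2 ^ q ∂(glue ψ π (ν : Measure Ω))) ^ (1 / (q : ℝ))
        ≤ (∫⁻ p, (edist p.1.1 p.1.2 + edist p.1.2 p.2) ^ q ∂(glue ψ π (ν : Measure Ω)))
          ^ (1 / (q : ℝ)) := by
          gcongr
          exact edist_triangle _ _ _
      _ ≤ _ := hmink
      _ ≤ _ := by gcongr

/-- Near every point of the ball there are points that have a coupling with the centre of cost
strictly below `ε ^ q`: move the point slightly towards the centre, where the transport along the
diagonal costs nothing. -/
theorem exists_lintegral_edist_pow_lt {q : ℕ} (hq : q ≠ 0) {ε : ℝ} (hε : 0 < ε)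
    {μ ν : ProbabilityMeasure Ω} (hμ : μ ∈ wassersteinBall q ε ν) {U : Set (ProbabilityMeasure Ω)} (hU : U ∈ 𝓝 μ) :
    ∃ μ' ∈ U, ∃ π ∈ couplings μ' ν, ∫⁻ z, edist z.1 z.2 ^ q ∂π < ENNReal.ofReal ε ^ q := by
  have hE0 : ENNReal.ofReal ε ^ q ≠ 0 := pow_ne_zero _ (by simpa using hε)
  have hEtop : ENNReal.ofReal ε ^ q ≠ ∞ := by finiteness
  set E := ENNReal.ofReal ε ^ q
  let t : ℕ → ℝ≥0 := fun n => 1 / ((n : ℝ≥0) + 2)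
  let s : ℕ → ℝ≥0 := fun n => (n + 1) / ((n : ℝ≥0) + 2)
  have hst : ∀ n, (s n : ℝ≥0∞) + t n = 1 := fun n => by
    rw [← ENNReal.coe_add, ← ENNReal.coe_one]
    congr 1
    simp only [s, t]
    field_simp
    ring
  have ht0 : ∀ n, t n ≠ 0 := fun n => by simp only [t]; positivity
  have htlim : Tendsto t atTop (𝓝 0) := by
    have := (tendsto_one_div_add_atTop_nhds_zero_nat (𝕜 := ℝ≥0)).comp (tendsto_add_atTop_nat 1)
    refine this.congr fun n => ?_
    simp only [Function.comp_apply, t]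
    push_cast
    rw [add_assoc, one_add_one_eq_two]
  have hslim : Tendsto s atTop (𝓝 1) := by
    have hs : ∀ n, 1 - t n = s n := fun n =>
      tsub_eq_of_eq_add (by exact_mod_cast (hst n).symm)
    simpa [hs] using (tendsto_const_nhds (x := (1 : ℝ≥0))).sub htlim
  -- The mixtures `s n • μ + t n • ν` tend to `μ`, and `s n < 1` lowers the cost.
  have hprob : ∀ n, IsProbabilityMeasure
      ((s n : ℝ≥0∞) • (μ : Measure Ω) + (t n : ℝ≥0∞) • (ν : Measure Ω)) := fun n =>
    ⟨by simp [hst]⟩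
  let m : ℕ → ProbabilityMeasure Ω := fun n => ⟨_, hprob n⟩
  have hm : Tendsto m atTop (𝓝 μ) := by
    refine ProbabilityMeasure.tendsto_iff_forall_lintegral_tendsto.2 fun f => ?_
    have hf : ∀ n, ∫⁻ x, f x ∂(m n : Measure Ω) =
        s n * ∫⁻ x, f x ∂(μ : Measure Ω) + t n * ∫⁻ x, f x ∂(ν : Measure Ω) := fun n => by
      simp only [m, ProbabilityMeasure.coe_mk, lintegral_add_measure, lintegral_smul_measure,
        smul_eq_mul]
    simp only [hf]
    have h1 := ENNReal.Tendsto.mul_const (b := ∫⁻ x, f x ∂(μ : Measure Ω))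
      (ENNReal.tendsto_coe.2 hslim) (Or.inr (f.lintegral_lt_top_of_nnreal _).ne)
    have h2 := ENNReal.Tendsto.mul_const (b := ∫⁻ x, f x ∂(ν : Measure Ω))
      (ENNReal.tendsto_coe.2 htlim) (Or.inr (f.lintegral_lt_top_of_nnreal _).ne)
    simpa using h1.add h2
  obtain ⟨n, hn⟩ := (hm.eventually_mem hU).exists
  refine ⟨m n, hn, ?_⟩
  have hs1 : (s n : ℝ≥0∞) < 1 := by
    rw [← hst n]
    exact ENNReal.lt_add_right ENNReal.coe_ne_top (by simpa using ht0 n)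
  have hs0 : (s n : ℝ≥0∞) ≠ 0 := by
    have : s n ≠ 0 := by simp only [s]; positivity
    simpa using this
  obtain ⟨π, hπ, hlt⟩ := (mem_wassersteinBall_iff hq).1 hμ (E / s n) (by
    rw [ENNReal.lt_div_iff_mul_lt (Or.inl hs0) (Or.inl ENNReal.coe_ne_top)]
    calc E * s n < E * 1 := ENNReal.mul_lt_mul_right hE0 hEtop hs1
      _ = E := mul_one E)
  refine ⟨(s n : ℝ≥0∞) • π + (t n : ℝ≥0∞) • (ν : Measure Ω).map (fun x => (x, x)), ⟨?_, ?_⟩, ?_⟩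
  · rw [Measure.map_add _ _ measurable_fst, Measure.map_smul, Measure.map_smul, hπ.1,
      (diagonal_mem_couplings ν).1]
    rfl
  · rw [Measure.map_add _ _ measurable_snd, Measure.map_smul, Measure.map_smul, hπ.2,
      (diagonal_mem_couplings ν).2, ← add_smul, hst, one_smul]
  · rw [lintegral_add_measure, lintegral_smul_measure, lintegral_smul_measure,
      lintegral_diagonal hq, smul_zero, add_zero, smul_eq_mul, mul_comm]
    exact (ENNReal.lt_div_iff_mul_lt (Or.inl hs0) (Or.inl ENNReal.coe_ne_top)).1 hlt

theorem hasFiniteMoment_of_coupling {q : ℕ} {μ ν : ProbabilityMeasure Ω}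
    (hν : HasFiniteMoment q ν) {π : Measure (Ω × Ω)} (hπ : π ∈ couplings μ ν)
    (hfin : ∫⁻ z, edist z.1 z.2 ^ q ∂π ≠ ∞) : HasFiniteMoment q μ := by
  rw [hasFiniteMoment_iff, ← lintegral_snd_of_mem_couplings hπ (by fun_prop)] at hν
  rw [hasFiniteMoment_iff, ← lintegral_fst_of_mem_couplings hπ (by fun_prop)]
  refine ne_top_of_le_ne_top ?_ (lintegral_mono fun z => enorm_pow_le q z.1 z.2)
  rw [lintegral_const_mul _ (by fun_prop), lintegral_add_left (by fun_prop)]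
  finiteness

/-- Lower hemicontinuity of the ball in its centre, from `τ_q` to the weak topology. -/
theorem eventually_wassersteinBall_inter_nonempty (hΩ : IsClosed Ω) {q : ℕ} (hq : q ≠ 0) {ε : ℝ}
    (hε : 0 < ε) {α : Type*} {l : Filter α} {νs : α → ProbabilityMeasure Ω}
    {ν : ProbabilityMeasure Ω} (h : Tendsto νs l (@nhds _ (tau Ω q) ν))
    (hνs : ∀ j, HasFiniteMoment q (νs j)) (hν : HasFiniteMoment q ν)
    {U : Set (ProbabilityMeasure Ω)} (hU : IsOpen U) (hne : (wassersteinBall q ε ν ∩ U).Nonempty) :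
    ∀ᶠ j in l, (wassersteinBall q ε (νs j) ∩ U).Nonempty := by
  obtain ⟨μ₀, hμ₀, hμ₀U⟩ := hne
  obtain ⟨μ, hμU, π, hπ, hlt⟩ := exists_lintegral_edist_pow_lt hq hε hμ₀ (hU.mem_nhds hμ₀U)
  obtain ⟨ι, _, ψ, κ, hψ, hsum, hκ, hfst, hcost⟩ := exists_mixCoupling hΩ hq
    (hasFiniteMoment_of_coupling hν hπ hlt.ne_top) hν hπ hlt
  have hprob : ∀ j, IsProbabilityMeasure ((mixCoupling ψ κ (νs j)).map Prod.fst) := fun j =>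
    have := isProbabilityMeasure_mixCoupling hψ hsum κ (νs j)
    Measure.isProbabilityMeasure_map measurable_fst.aemeasurable
  obtain ⟨μs, hμs⟩ : ∃ μs : α → ProbabilityMeasure Ω, ∀ j,
      (μs j : Measure Ω) = (mixCoupling ψ κ (νs j)).map Prod.fst :=
    ⟨fun j => ⟨_, hprob j⟩, fun _ => rfl⟩
  have hlim : Tendsto μs l (𝓝 μ) :=
    tendsto_fst_mixCoupling hψ hsum κ (tendsto_of_tendsto_tau h) hμs hfst.symm
  filter_upwards [hlim.eventually_mem (hU.mem_nhds hμU),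
    (tendsto_lintegral_mixCoupling hψ hsum hκ h hνs hν).eventually_lt_const hcost] with j hjU hj
  refine ⟨_, (mem_wassersteinBall_iff hq).2 fun C hC => ?_, hjU⟩
  exact ⟨_, ⟨(hμs j).symm, map_snd_mixCoupling hψ hsum κ (νs j)⟩, hj.trans hC⟩

/-- Wasserstein balls around centres that depend `τ_q`-continuously on a parameter. -/
theorem isCompactContinuous_wassersteinBall (hΩ : IsClosed Ω) {q : ℕ} (hq : q ≠ 0) {ε : ℝ}
    (hε : 0 < ε) {X : Type*} [TopologicalSpace X] {Phat : X → ProbabilityMeasure Ω}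
    (hcont : ∀ x, Tendsto Phat (𝓝 x) (@nhds _ (tau Ω q) (Phat x)))
    (hmom : ∀ x, HasFiniteMoment q (Phat x)) :
    IsCompactContinuous fun x => wassersteinBall q ε (Phat x) where
  nonempty x := ⟨_, self_mem_wassersteinBall hq ε _⟩
  isCompact x := by
    refine isCompact_iff_ultrafilter_le_nhds.2 fun F hF => ?_
    exact exists_tendsto_mem_wassersteinBall hΩ hq F (μs := id)
      (tendsto_tau_iff.2 fun _ _ => tendsto_const_nhds) (fun _ => hmom x) (hmom x)
      (le_principal_iff.1 hF)
  upper := by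
    refine upperHemicontinuous_iff_isOpen_subset.2 fun U hU => isOpen_iff_mem_nhds.2 fun x hx => ?_
    by_contra hcon
    -- Otherwise an ultrafilter converging to `x` selects measures outside `U`.
    have hfreq : ∃ᶠ x' in 𝓝 x, ∃ μ ∈ wassersteinBall q ε (Phat x'), μ ∉ U :=
      fun h => hcon (h.mono fun x' hx' μ hμ => by_contra fun hμU => hx' ⟨μ, hμ, hμU⟩)
    have := frequently_iff_neBot.1 hfreq
    obtain ⟨F, hle⟩ := Ultrafilter.exists_le
      (𝓝 x ⊓ 𝓟 {x' | ∃ μ ∈ wassersteinBall q ε (Phat x'), μ ∉ U})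
    have hFx : (F : Filter X) ≤ 𝓝 x := hle.trans inf_le_left
    have hF : ∀ᶠ x' in (F : Filter X), ∃ μ ∈ wassersteinBall q ε (Phat x'), μ ∉ U :=
      le_principal_iff.1 (hle.trans inf_le_right)
    have hsel : ∀ x', ∃ μ, (∃ μ ∈ wassersteinBall q ε (Phat x'), μ ∉ U) →
        μ ∈ wassersteinBall q ε (Phat x') ∧ μ ∉ U := fun x' => by
      by_cases h : ∃ μ ∈ wassersteinBall q ε (Phat x'), μ ∉ U
      · exact ⟨h.choose, fun _ => h.choose_spec⟩
      · exact ⟨Phat x', fun h' => absurd h' h⟩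
    choose μs hμs using hsel
    obtain ⟨μ, hμ, hlim⟩ := exists_tendsto_mem_wassersteinBall hΩ hq F (μs := μs)
      ((hcont x).mono_left hFx) hmom (hmom x) (hF.mono fun x' h => (hμs x' h).1)
    obtain ⟨x', h1, h2⟩ :=
      ((hlim.eventually_mem (hU.mem_nhds (hx hμ))).and (hF.mono fun x' h => (hμs x' h).2)).exists
    exact h2 h1
  lower := by
    refine lowerHemicontinuous_iff_isOpen_inter.2 fun U hU => isOpen_iff_mem_nhds.2 fun x hx => ?_
    exact eventually_wassersteinBall_inter_nonempty hΩ hq hε (hcont x) hmom (hmom x) hU hx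

end WassersteinAmbiguity

theorem proposition3p1 {d m : ℕ}
    (Ω : Set (EuclideanSpace ℝ (Fin d))) (hΩ : IsClosed Ω)
    (A : Set (EuclideanSpace ℝ (Fin m))) (hA : IsCompact A)
    (q : ℕ) (hq : 1 ≤ q) (ε : ℝ) (hε : 0 < ε)
    (Phat : Ω × A → ProbabilityMeasure Ω)
    (hcont : Continuous[inferInstance, tau Ω q] Phat)
    (hmom : ∀ z, HasFiniteMoment q (Phat z)) :
    IsCompactContinuous (fun z : Ω × A => wassersteinBall q ε (Phat z)) ∧
      IsAmbiguityCorrespondence 0 (fun z : Ω × A => wassersteinBall q ε (Phat z)) := by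
  have h : IsCompactContinuous (fun z : Ω × A => wassersteinBall q ε (Phat z)) :=
    isCompactContinuous_wassersteinBall hΩ (Nat.one_le_iff_ne_zero.1 hq) hε
      (fun z => (@continuous_iff_continuousAt _ _ _ (tau Ω q) _).1 hcont z) hmom
  refine ⟨h, ⟨?_, 1, le_rfl, fun x a μ _ => ?_⟩⟩
  · rw [tau_zero]
    exact h
  · simp
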